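/- For $n\ge 0$ let $a_{2,7}(n)$ denote the number of partitions of $n$ into pairwise distinct parts none of which is divisible by $2$ or by $7$, and for $k\ge 1$ let $f_k=\prod_{m=1}^{\infty}(1-q^{km})\in\mathbb{Z}[[q]]$. Two power series in $\mathbb{Z}[[q]]$ are called congruent modulo $2$ if their corresponding coefficients are congruent modulo $2$. Let $p>7$ be a prime with Legendre symbol $\left(\frac{-14}{p}\right)=-1$, and let $1\le j\le p-1$. Then for all integers $\alpha\ge 0$, $$\sum_{n=0}^{\infty} a_{2,7}\Big(2p^{2\alpha}n+\frac{5p^{2\alpha}-1}{4}\Big)q^n\equiv f_1f_{14}\pmod 2,$$ $$\sum_{n=0}^{\infty} a_{2,7}\Big(14p^{2\alpha}n+\frac{21p^{2\alpha}-1}{4}\Big)q^n\equiv f_2f_7\pmod 2,$$ and, for all integers $n\ge 0$, $$a_{2,7}\Big(2p^{2\alpha+1}(pn+j)+\frac{5p^{2\alpha+2}-1}{4}\Big)\equiv 0\pmod 2,$$ $$a_{2,7}\Big(14p^{2\alpha+1}(pn+j)+\frac{21p^{2\alpha+2}-1}{4}\Big)\equiv 0\pmod 2.$$ -/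

import Mathlib

namespace RegularDistinct

open scoped PowerSeries.WithPiTopology

/-- The number of `(r, s)`-regular partitions of `n` into distinct parts: partitions of `n` with
pairwise distinct parts, none of which is divisible by `r` or by `s`. -/
def a (r s n : ℕ) : ℕ :=
  ((Nat.Partition.distincts n).filter fun π => ∀ i ∈ π.parts, ¬ r ∣ i ∧ ¬ s ∣ i).card

/-- The formal power series `f_k = (q^k; q^k)_∞ = ∏_{n ≥ 0} (1 - q^k (q^k)^n)` over `ℤ`, for
`k ≥ 1`; the infinite product is taken in the topology of coefficientwise convergence, `ℤ` being
discrete. -/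
noncomputable def f (k : ℕ) : PowerSeries ℤ :=
  ∏' n : ℕ, (1 - PowerSeries.X ^ k * (PowerSeries.X ^ k) ^ n)

/-- The product that defines `f k` converges for `k ≥ 1`. -/
theorem multipliable_f {k : ℕ} (hk : 1 ≤ k) :
    Multipliable fun n : ℕ =>
      (1 - PowerSeries.X ^ k * (PowerSeries.X ^ k) ^ n : PowerSeries ℤ) := by
  simp_rw [sub_eq_add_neg]
  apply PowerSeries.WithPiTopology.multipliable_one_add_of_tendsto_order_atTop_nhds_top
  refine ENat.tendsto_nhds_top_iff_natCast_lt.mpr fun N =>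
    Filter.eventually_atTop.mpr ⟨N, fun m hm => ?_⟩
  rw [← pow_mul, ← pow_add, PowerSeries.order_neg, PowerSeries.order_X_pow]
  have h : N < k + k * m := by nlinarith
  exact_mod_cast h

/-- Two integer power series are congruent modulo `m` if all their coefficients are. -/
def SeriesModEq (m : ℤ) (A B : PowerSeries ℤ) : Prop :=
  ∀ n : ℕ, PowerSeries.coeff n A ≡ PowerSeries.coeff n B [ZMOD m]

end RegularDistinct

/-!
Modulo `2` the generating function of `a 2 7`, multiplied by `f 2`, is `f 1 * f 7`. By the
pentagonal number theorem `f a * f b` modulo `2` counts the representations of numbers by the form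
`a x² + b y²` with `x` and `y` prime to `6`. For `x² + 7 y²`, multiplication by a prime above `2` of
`ℚ(√-7)` shows that doubling a multiple of `8` preserves the number of representations, and complex
conjugation shows that a number `8 m` with `m` odd has an even number of them unless `m` or `7 m` is
a square. It follows that the odd part of `f 1 * f 7` is `f 2 * f 14`, hence the odd part of the
generating function is `f 1 * f 14`: for odd `n`, the parity of `a 2 7 n` is that of the number of
representations of `12 n + 3` by `x² + 14 y²`. A prime `p` that is inert in `ℚ(√-14)` and divides
`x² + 14 y²` divides both `x` and `y`.
-/

namespace RegularDistinct

open scoped PowerSeries.WithPiTopology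
open PowerSeries

theorem continuous_expand {R : Type*} [CommRing R] [TopologicalSpace R] {k : ℕ} (hk : k ≠ 0) :
    Continuous (expand k hk : R⟦X⟧ → R⟦X⟧) := by
  refine continuous_iff_continuousAt.mpr fun g => ?_
  rw [ContinuousAt, WithPiTopology.tendsto_iff_coeff_tendsto]
  intro d
  simp only [coeff_expand]
  split_ifs
  · exact (WithPiTopology.continuous_coeff R _).tendsto g
  · exact tendsto_const_nhds

theorem hasProd_expand_pentagonalSeries (R : Type*) [CommRing R] [TopologicalSpace R] {k : ℕ}
    (hk : k ≠ 0) :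
    HasProd (fun n : ℕ => (1 - X ^ (k * (n + 1)) : R⟦X⟧)) (expand k hk (pentagonalSeries R)) := by
  simpa [Function.comp_def, ← pow_mul] using
    (WithPiTopology.hasProd_one_sub_X_pow R).map (expand k hk) (continuous_expand hk)

theorem f_eq_expand {k : ℕ} (hk : k ≠ 0) : f k = expand k hk (pentagonalSeries ℤ) := by
  simpa only [f, ← pow_mul, ← pow_add, mul_add_one, add_comm] using
    (hasProd_expand_pentagonalSeries ℤ hk).tprod_eq

theorem map_pentagonalSeries {R S : Type*} [CommRing R] [CommRing S] (φ : R →+* S) :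
    map φ (pentagonalSeries R) = pentagonalSeries S := by
  ext n
  rw [coeff_map]
  by_cases hn : n ∈ Set.range pentagonal
  · obtain ⟨k, rfl⟩ := hn
    simp
  · rw [coeff_pentagonalSeries_eq_zero R hn, coeff_pentagonalSeries_eq_zero S hn, map_zero]

/-- The reduction of `f k` modulo `2`. -/
noncomputable def fModTwo (k : ℕ) : (ZMod 2)⟦X⟧ :=
  map (Int.castRingHom (ZMod 2)) (f k)

theorem fModTwo_eq_expand {k : ℕ} (hk : k ≠ 0) :
    fModTwo k = expand k hk (pentagonalSeries (ZMod 2)) := by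
  rw [fModTwo, f_eq_expand hk, map_expand, map_pentagonalSeries]

theorem expand_two_eq_sq (A : (ZMod 2)⟦X⟧) : expand 2 two_ne_zero A = A ^ 2 := by
  have h := MvPowerSeries.map_frobenius_expand (σ := Unit) 2 two_ne_zero (f := A)
  rwa [ZMod.frobenius_zmod, MvPowerSeries.map_id] at h

theorem fModTwo_two_mul (k : ℕ) [NeZero k] : fModTwo (2 * k) = fModTwo k ^ 2 := by
  rw [fModTwo_eq_expand (NeZero.ne k), ← expand_two_eq_sq, ← expand_mul,
    fModTwo_eq_expand (NeZero.ne (2 * k))]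

theorem fModTwo_ne_zero (k : ℕ) [NeZero k] : fModTwo k ≠ 0 := by
  have h0 : pentagonal 0 = 0 := by simp [pentagonal_def]
  have h1 : constantCoeff (fModTwo k) = 1 := by
    rw [fModTwo_eq_expand (NeZero.ne k), constantCoeff_expand, ← coeff_zero_eq_constantCoeff_apply,
      ← h0, coeff_pentagonalSeries_pentagonal]
    simp
  intro h
  simp [h] at h1

theorem hasProd_fModTwo (k : ℕ) [NeZero k] :
    HasProd (fun n : ℕ => (if k ∣ n + 1 then 1 - X ^ (n + 1) else 1 : (ZMod 2)⟦X⟧))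
      (fModTwo k) := by
  have hk : 0 < k := NeZero.pos k
  have hpos (n : ℕ) : 0 < k * (n + 1) := by positivity
  have hinj : Function.Injective fun n : ℕ => k * (n + 1) - 1 := fun m n h => by
    have h' : k * (m + 1) = k * (n + 1) := by
      have := hpos m
      have := hpos n
      simp only at h
      omega
    simpa [hk.ne'] using h'
  rw [← hinj.hasProd_iff, fModTwo_eq_expand hk.ne']
  · convert hasProd_expand_pentagonalSeries (ZMod 2) hk.ne' using 2 with n
    simp [Nat.sub_add_cancel (hpos n)]
  · refine fun n hn => if_neg ?_
    rintro ⟨_ | c, hc⟩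
    · simp at hc
    · exact hn ⟨c, by simp [← hc]⟩

/-- The generating function of `a r s` modulo `2`. -/
noncomputable def genA (r s : ℕ) : (ZMod 2)⟦X⟧ :=
  PowerSeries.mk fun n => (a r s n : ZMod 2)

theorem genA_eq_genFun (r s : ℕ) : genA r s = Nat.Partition.genFun
    fun i c => if c ≤ 1 ∧ ¬ r ∣ i ∧ ¬ s ∣ i then (1 : ZMod 2) else 0 := by
  ext n
  rw [genA, coeff_mk, Nat.Partition.coeff_genFun, a, ← Nat.Partition.countRestricted_two,
    Nat.Partition.countRestricted, Finset.filter_filter, Finset.natCast_card_filter]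
  refine Finset.sum_congr rfl fun π _ => ?_
  rw [Finsupp.prod, Finset.prod_ite_zero]
  simp only [Finset.prod_const_one, Multiset.toFinsupp_support, Multiset.mem_toFinset,
    Multiset.toFinsupp_apply, Nat.lt_succ_iff, forall₂_and]

theorem hasProd_genA (r s : ℕ) :
    HasProd (fun n : ℕ =>
      (if ¬ r ∣ n + 1 ∧ ¬ s ∣ n + 1 then 1 - X ^ (n + 1) else 1 : (ZMod 2)⟦X⟧)) (genA r s) := by
  rw [genA_eq_genFun]
  refine (Nat.Partition.hasProd_genFun _).congr_fun fun n => ?_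
  rw [tsum_eq_single 0 fun j hj => by rw [if_neg (by omega), zero_smul]]
  by_cases h : ¬ r ∣ n + 1 ∧ ¬ s ∣ n + 1
  · rw [if_pos h, if_pos ⟨by rfl, by simpa using h⟩, one_smul, zero_add, mul_one]
    ext d
    simp [CharTwo.sub_eq_add]
  · simp [h]

theorem genA_mul_fModTwo {r s : ℕ} [NeZero r] [NeZero s] (hrs : r.Coprime s) :
    genA r s * fModTwo r * fModTwo s = fModTwo 1 * fModTwo (r * s) := by
  refine (((hasProd_genA r s).mul (hasProd_fModTwo r)).mul (hasProd_fModTwo s)).unique ?_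
  convert (hasProd_fModTwo 1).mul (hasProd_fModTwo (r * s)) using 2 with n
  have hdvd : r * s ∣ n + 1 ↔ r ∣ n + 1 ∧ s ∣ n + 1 :=
    ⟨fun h => ⟨dvd_of_mul_right_dvd h, dvd_of_mul_left_dvd h⟩,
      fun h => hrs.mul_dvd_of_dvd_of_dvd h.1 h.2⟩
  by_cases hr : r ∣ n + 1 <;> by_cases hs : s ∣ n + 1 <;> simp [hdvd, hr, hs]

theorem mk_coeff_mul_expand {R : Type*} [CommRing R] {m r : ℕ} (hm : m ≠ 0) (hr : r < m)
    (A B : R⟦X⟧) :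
    (PowerSeries.mk fun n => coeff (m * n + r) (A * expand m hm B)) =
      (PowerSeries.mk fun n => coeff (m * n + r) A) * B := by
  ext n
  rw [coeff_mk, coeff_mul, coeff_mul]
  symm
  refine Finset.sum_of_injOn (fun ij => (m * ij.1 + r, m * ij.2)) ?_ ?_ ?_ ?_
  · rintro ⟨i, j⟩ - ⟨k, l⟩ - h
    simpa [hm] using h
  · rintro ⟨i, j⟩ h
    simp only [Finset.mem_coe, Finset.HasAntidiagonal.mem_antidiagonal] at h ⊢
    rw [← h]
    ring
  · rintro ⟨i, j⟩ h h'
    rw [coeff_expand_of_not_dvd, mul_zero]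
    rintro ⟨l, rfl⟩
    replace h : i + m * l = m * n + r := by simpa using h
    have hl : l ≤ n := by
      by_contra! hl
      have : m * (n + 1) ≤ m * l := Nat.mul_le_mul_left m hl
      rw [mul_add_one] at this
      omega
    obtain ⟨k, rfl⟩ := Nat.exists_eq_add_of_le' hl
    exact h' ⟨(k, l), by simp, by simp only [Prod.mk.injEq, and_true]; linarith⟩
  · rintro ⟨i, j⟩ -
    simp [coeff_expand_mul]

theorem coeff_fModTwo (k n : ℕ) [NeZero k] [Decidable (∃ l, n = k * pentagonal l)] :
    coeff n (fModTwo k) = if ∃ l, n = k * pentagonal l then 1 else 0 := by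
  rw [fModTwo_eq_expand (NeZero.ne k)]
  split_ifs with h
  · obtain ⟨l, rfl⟩ := h
    rw [coeff_expand_mul, coeff_pentagonalSeries_pentagonal]
    rcases Int.even_or_odd l with hl | hl
    · simp [Int.negOnePow_even _ hl]
    · simp [Int.negOnePow_odd _ hl]
  · by_cases hn : k ∣ n
    · obtain ⟨m, rfl⟩ := hn
      rw [coeff_expand_mul, coeff_pentagonalSeries_eq_zero]
      rintro ⟨l, rfl⟩
      exact h ⟨l, rfl⟩
    · exact coeff_expand_of_not_dvd k _ _ hn

theorem coprime_six_iff {x : ℕ} : x.Coprime 6 ↔ x.Coprime 2 ∧ ¬ 3 ∣ x := by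
  rw [← Nat.prime_three.coprime_iff_not_dvd, Nat.coprime_comm (n := 3),
    ← Nat.coprime_mul_iff_right]

theorem coprime_six_iff_exists_natAbs {x : ℕ} :
    x.Coprime 6 ↔ ∃ k : ℤ, x = (6 * k - 1).natAbs := by
  rw [coprime_six_iff, Nat.coprime_two_right]
  constructor
  · rintro ⟨⟨m, rfl⟩, h3⟩
    have h : (2 * m + 1) % 6 = 1 ∨ (2 * m + 1) % 6 = 5 := by omega
    rcases h with h | h
    · exact ⟨-((2 * m + 1) / 6 : ℕ), by omega⟩
    · exact ⟨((2 * m + 1) / 6 + 1 : ℕ), by omega⟩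
  · rintro ⟨k, rfl⟩
    exact ⟨by rw [Nat.odd_iff]; omega, by omega⟩

theorem natAbs_six_mul_sub_one_sq (k : ℤ) : (6 * k - 1).natAbs ^ 2 = 24 * pentagonal k + 1 := by
  zify
  rw [sq_abs]
  linear_combination -12 * two_mul_natCast_pentagonal k

/-- The representations of `N` by the form `a x² + b y²` with `x` and `y` natural numbers prime to
`d`. The search range is large enough only for `a` and `b` nonzero. -/
def reps (d a b N : ℕ) : Finset (ℕ × ℕ) :=
  (Finset.range (N + 1) ×ˢ Finset.range (N + 1)).filter fun z =>
    z.1.Coprime d ∧ z.2.Coprime d ∧ a * z.1 ^ 2 + b * z.2 ^ 2 = N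

theorem mem_reps {d a b N x y : ℕ} [NeZero a] [NeZero b] :
    (x, y) ∈ reps d a b N ↔ x.Coprime d ∧ y.Coprime d ∧ a * x ^ 2 + b * y ^ 2 = N := by
  rw [reps, Finset.mem_filter, and_iff_right_of_imp]
  rintro ⟨-, -, h⟩
  have hx : x ≤ a * x ^ 2 :=
    (Nat.le_self_pow two_ne_zero x).trans (Nat.le_mul_of_pos_left _ (NeZero.pos a))
  have hy : y ≤ b * y ^ 2 :=
    (Nat.le_self_pow two_ne_zero y).trans (Nat.le_mul_of_pos_left _ (NeZero.pos b))
  simp only [Finset.mem_product, Finset.mem_range] at h ⊢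
  omega

theorem mem_reps_six_iff_exists {a b n : ℕ} [NeZero a] [NeZero b] {z : ℕ × ℕ} :
    z ∈ reps 6 a b (24 * n + a + b) ↔ ∃ k l : ℤ,
      z = ((6 * k - 1).natAbs, (6 * l - 1).natAbs) ∧ a * pentagonal k + b * pentagonal l = n := by
  have hsum (k l : ℤ) : a * (6 * k - 1).natAbs ^ 2 + b * (6 * l - 1).natAbs ^ 2 =
      24 * (a * pentagonal k + b * pentagonal l) + a + b := by
    rw [natAbs_six_mul_sub_one_sq, natAbs_six_mul_sub_one_sq]
    ring
  obtain ⟨x, y⟩ := z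
  rw [mem_reps, coprime_six_iff_exists_natAbs, coprime_six_iff_exists_natAbs]
  constructor
  · rintro ⟨⟨k, rfl⟩, ⟨l, rfl⟩, h⟩
    rw [hsum] at h
    exact ⟨k, l, rfl, by omega⟩
  · rintro ⟨k, l, h, rfl⟩
    obtain ⟨rfl, rfl⟩ := Prod.mk.inj h
    exact ⟨⟨k, rfl⟩, ⟨l, rfl⟩, hsum k l⟩

theorem coeff_fModTwo_mul_fModTwo (a b n : ℕ) [NeZero a] [NeZero b] :
    coeff n (fModTwo a * fModTwo b) = ((reps 6 a b (24 * n + a + b)).card : ZMod 2) := by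
  classical
  simp only [coeff_mul, coeff_fModTwo, mul_ite, mul_one, mul_zero, ← ite_and]
  rw [Finset.sum_boole]
  congr 1
  symm
  refine Finset.card_bij
    (fun z _ => (a * ((z.1 ^ 2 - 1) / 24), b * ((z.2 ^ 2 - 1) / 24))) ?_ ?_ ?_
  · intro z hz
    obtain ⟨k, l, rfl, hkl⟩ := mem_reps_six_iff_exists.mp hz
    simpa [natAbs_six_mul_sub_one_sq] using hkl
  · intro z hz z' hz' h
    obtain ⟨k, l, rfl, -⟩ := mem_reps_six_iff_exists.mp hz
    obtain ⟨k', l', rfl, -⟩ := mem_reps_six_iff_exists.mp hz'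
    have hpent : pentagonal k = pentagonal k' ∧ pentagonal l = pentagonal l' := by
      simpa [natAbs_six_mul_sub_one_sq, NeZero.ne a, NeZero.ne b] using h
    rw [pentagonal_injective hpent.1, pentagonal_injective hpent.2]
  · rintro ⟨i, j⟩ h
    simp only [Finset.mem_filter, Finset.HasAntidiagonal.mem_antidiagonal] at h
    obtain ⟨hkl, ⟨l, rfl⟩, ⟨k, rfl⟩⟩ := h
    exact ⟨((6 * k - 1).natAbs, (6 * l - 1).natAbs),
      mem_reps_six_iff_exists.mpr ⟨k, l, rfl, hkl⟩, by simp [natAbs_six_mul_sub_one_sq]⟩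

theorem reps_mul_mul (d a b N : ℕ) {c : ℕ} [NeZero a] [NeZero b] [NeZero c] :
    reps d (c * a) (c * b) (c * N) = reps d a b N := by
  ext ⟨x, y⟩
  simp only [mem_reps, mul_assoc, ← mul_add, mul_right_inj' (NeZero.ne c)]

theorem card_reps_one_mul_prime {q : ℕ} (hq : q.Prime) {d : ℕ} (hqd : q.Coprime d) (b N : ℕ)
    [NeZero b] : (reps d 1 (q * b) (q * N)).card = (reps d b q N).card := by
  have : NeZero q := ⟨hq.ne_zero⟩
  symm
  refine Finset.card_bij (fun z _ => (q * z.2, z.1)) ?_ ?_ ?_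
  · rintro ⟨x, y⟩ hz
    obtain ⟨hx, hy, rfl⟩ := mem_reps.mp hz
    exact mem_reps.mpr ⟨hqd.mul_left hy, hx, by ring⟩
  · rintro ⟨x, y⟩ - ⟨x', y'⟩ - h
    simpa [hq.ne_zero, and_comm] using h
  · rintro ⟨x, y⟩ hz
    obtain ⟨hx, hy, h⟩ := mem_reps.mp hz
    rw [one_mul, mul_assoc] at h
    have hqx : q ∣ x ^ 2 := (Nat.dvd_add_left (dvd_mul_right q _)).mp (h ▸ dvd_mul_right q N)
    obtain ⟨w, rfl⟩ := hq.dvd_of_dvd_pow hqx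
    refine ⟨(y, w), mem_reps.mpr ⟨hy, hx.coprime_mul_left, ?_⟩, rfl⟩
    refine Nat.eq_of_mul_eq_mul_left hq.pos ?_
    rw [← h]
    ring

theorem sq_mod_three_eq_ite (x : ℕ) : x ^ 2 % 3 = if 3 ∣ x then 0 else 1 := by
  have h : x % 3 = 0 ∨ x % 3 = 1 ∨ x % 3 = 2 := by omega
  rcases h with h | h | h <;> simp [Nat.pow_mod, Nat.dvd_iff_mod_eq_zero, h]

theorem reps_six_eq_reps_two {N : ℕ} (hN : N % 3 = 2) : reps 6 1 7 N = reps 2 1 7 N := by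
  ext ⟨x, y⟩
  simp only [mem_reps, coprime_six_iff]
  have hx := sq_mod_three_eq_ite x
  have hy := sq_mod_three_eq_ite y
  constructor
  · rintro ⟨⟨hx2, -⟩, ⟨hy2, -⟩, h⟩
    exact ⟨hx2, hy2, h⟩
  · rintro ⟨hx2, hy2, h⟩
    have h3 : ¬ 3 ∣ x ∧ ¬ 3 ∣ y := by split_ifs at hx hy <;> omega
    exact ⟨⟨hx2, h3.1⟩, ⟨hy2, h3.2⟩, h⟩

theorem not_isSquare_of_mod_three_eq_two {m : ℕ} (hm : m % 3 = 2) : ¬ IsSquare m := by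
  rintro ⟨x, rfl⟩
  have hx := sq_mod_three_eq_ite x
  rw [← sq] at hm
  split_ifs at hx <;> omega

/-- Up to sign, `x + y √-7 = 2 ω (y + t ω̄)` with `ω = (1 + √-7) / 2`. -/
theorem mem_reps_one_seven_iff_exists {N : ℕ} {z : ℕ × ℕ} :
    z ∈ reps 2 1 7 N ↔ ∃ y t : ℤ, Odd y ∧ z = ((y + 4 * t).natAbs, y.natAbs) ∧
      8 * (y ^ 2 + y * t + 2 * t ^ 2) = N := by
  obtain ⟨u, v⟩ := z
  simp only [mem_reps, Nat.coprime_two_right, Prod.mk.injEq, one_mul]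
  constructor
  · rintro ⟨hu, hv, rfl⟩
    rw [Nat.odd_iff] at hu hv
    have hsign : ∃ y t : ℤ, (u : ℤ) = y + 4 * t ∧ (y = v ∨ y = -v) := by
      by_cases h : ((u : ℤ) - v) % 4 = 0
      · exact ⟨v, (u - v) / 4, by omega, .inl rfl⟩
      · exact ⟨-v, (u + v) / 4, by omega, .inr rfl⟩
    obtain ⟨y, t, hut, hyv⟩ := hsign
    refine ⟨y, t, by rw [Int.odd_iff]; omega, ⟨by omega, by omega⟩, ?_⟩
    have hsq : (v : ℤ) ^ 2 = y ^ 2 := by rcases hyv with rfl | rfl <;> ring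
    push_cast
    rw [hut, hsq]
    ring
  · rintro ⟨y, t, hy, ⟨rfl, rfl⟩, h⟩
    rw [Int.odd_iff] at hy
    refine ⟨by rw [Nat.odd_iff]; omega, by rw [Nat.odd_iff]; omega, ?_⟩
    zify
    rw [sq_abs, sq_abs, ← h]
    ring

/-- Multiplication by the prime element `ω = (1 + √-7) / 2` above `2`, on the pairs of odd numbers
`(x, y)` that stand for `x + y √-7 = 2 ω (y + t ω̄)`; the sign of `y` is chosen such that
`x ≡ y [ZMOD 4]`. In terms of `y + t ω̄` it maps `(y, t)` to `(y + 2 t, -y)`. -/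
def doubleNorm (z : ℕ × ℕ) : ℕ × ℕ :=
  if ((z.1 : ℤ) - z.2) % 4 = 0 then
    ((((z.1 : ℤ) - 7 * z.2) / 2).natAbs, (z.1 + z.2) / 2)
  else ((z.1 + 7 * z.2) / 2, (((z.1 : ℤ) - z.2) / 2).natAbs)

theorem doubleNorm_natAbs {y : ℤ} (hy : Odd y) (t : ℤ) :
    doubleNorm ((y + 4 * t).natAbs, y.natAbs) =
      ((y + 2 * t + 4 * -y).natAbs, (y + 2 * t).natAbs) := by
  rw [Int.odd_iff] at hy
  simp only [doubleNorm]
  split_ifs <;> simp only [Prod.mk.injEq] <;> omega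

theorem card_reps_one_seven_two_mul {N : ℕ} (hN : 8 ∣ N) :
    (reps 2 1 7 (2 * N)).card = (reps 2 1 7 N).card := by
  symm
  refine Finset.card_bij (fun z _ => doubleNorm z) ?_ ?_ ?_
  · intro z hz
    obtain ⟨y, t, hy, rfl, h⟩ := mem_reps_one_seven_iff_exists.mp hz
    rw [doubleNorm_natAbs hy, mem_reps_one_seven_iff_exists]
    refine ⟨y + 2 * t, -y, hy.add_even (even_two_mul t), rfl, ?_⟩
    push_cast
    rw [← h]
    ring
  · intro z hz z' hz' hzz'
    obtain ⟨y, t, hy, rfl, -⟩ := mem_reps_one_seven_iff_exists.mp hz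
    obtain ⟨y', t', hy', rfl, -⟩ := mem_reps_one_seven_iff_exists.mp hz'
    rw [doubleNorm_natAbs hy, doubleNorm_natAbs hy', Prod.mk.injEq] at hzz'
    rw [Int.odd_iff] at hy hy'
    rw [Prod.mk.injEq]
    omega
  · intro z hz
    obtain ⟨y, t, hy, rfl, h⟩ := mem_reps_one_seven_iff_exists.mp hz
    obtain ⟨M, rfl⟩ := hN
    have heven : Even (y * (y + t)) := ⟨M - t ^ 2, by push_cast at h; linarith⟩
    obtain ⟨w, hw⟩ := (Int.even_mul.mp heven).resolve_left (Int.not_even_iff_odd.mpr hy)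
    have ht : Odd (-t) := by
      rw [Int.odd_iff] at hy ⊢
      omega
    obtain rfl : t = 2 * w - y := by linarith
    refine ⟨((-(2 * w - y) + 4 * w).natAbs, (-(2 * w - y)).natAbs),
      mem_reps_one_seven_iff_exists.mpr ⟨-(2 * w - y), w, ht, rfl, ?_⟩, ?_⟩
    · push_cast at h ⊢
      linarith
    · rw [doubleNorm_natAbs ht]
      congr 2 <;> ring

/-- Conjugation of `y + t ω̄`, in case it lies in `ℤ[√-7]`, on the pairs of odd numbers `(x, y)`
that stand for `x + y √-7 = 2 ω (y + t ω̄)` with `ω = (1 + √-7) / 2`; the sign of `y` is chosen such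
that `x ≡ y [ZMOD 8]`. With `t = 2 s` it maps `(y, s)` to `(y + 2 s, -s)`. -/
def conjugate (z : ℕ × ℕ) : ℕ × ℕ :=
  if ((z.1 : ℤ) - z.2) % 8 = 0 then
    (((7 * (z.2 : ℤ) - 3 * z.1) / 4).natAbs, (3 * z.2 + z.1) / 4)
  else ((7 * z.2 + 3 * z.1) / 4, ((3 * (z.2 : ℤ) - z.1) / 4).natAbs)

theorem conjugate_natAbs {y : ℤ} (hy : Odd y) (s : ℤ) :
    conjugate ((y + 8 * s).natAbs, y.natAbs) =
      ((y + 2 * s + 8 * -s).natAbs, (y + 2 * s).natAbs) := by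
  rw [Int.odd_iff] at hy
  simp only [conjugate]
  split_ifs <;> simp only [Prod.mk.injEq] <;> omega

theorem mem_reps_one_seven_eight_mul_iff_exists {m : ℕ} (hm : Odd m) {z : ℕ × ℕ} :
    z ∈ reps 2 1 7 (8 * m) ↔ ∃ y s : ℤ, Odd y ∧ z = ((y + 8 * s).natAbs, y.natAbs) ∧
      (y + s) ^ 2 + 7 * s ^ 2 = m := by
  rw [mem_reps_one_seven_iff_exists]
  constructor
  · rintro ⟨y, t, hy, rfl, h⟩
    have hmt : y ^ 2 + y * t + 2 * t ^ 2 = m := by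
      push_cast at h
      linarith
    have ht : Even t := by
      by_contra hc
      rw [Int.not_even_iff_odd] at hc
      have : Even (m : ℤ) := hmt ▸ (hy.pow.add_odd (hy.mul hc)).add (even_two_mul _)
      exact Nat.not_even_iff_odd.mpr hm (by exact_mod_cast this)
    obtain ⟨s, rfl⟩ := ht
    refine ⟨y, s, hy, by ring_nf, ?_⟩
    rw [← hmt]
    ring
  · rintro ⟨y, s, hy, rfl, h⟩
    refine ⟨y, 2 * s, hy, by ring_nf, ?_⟩
    push_cast
    rw [← h]
    ring

theorem even_card_reps_one_seven_eight_mul {m : ℕ} (hm : Odd m) (h1 : ¬ IsSquare m)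
    (h7 : ¬ IsSquare (7 * m)) : Even (reps 2 1 7 (8 * m)).card := by
  rw [← ZMod.natCast_eq_zero_iff_even, Finset.card_eq_sum_ones, Nat.cast_sum]
  refine Finset.sum_involution (fun z _ => conjugate z) (fun z _ => by decide) ?_ ?_ ?_
  · rintro z hz - hfix
    obtain ⟨y, s, hy, rfl, h⟩ := (mem_reps_one_seven_eight_mul_iff_exists hm).mp hz
    rw [conjugate_natAbs hy, Prod.mk.injEq] at hfix
    obtain rfl | hys : s = 0 ∨ y + s = 0 := by omega
    · refine h1 ⟨y.natAbs, ?_⟩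
      zify
      rw [← h, ← sq, sq_abs]
      ring
    · refine h7 ⟨7 * s.natAbs, ?_⟩
      zify
      rw [← h, hys, ← sq, mul_pow, sq_abs]
      ring
  · intro z hz
    obtain ⟨y, s, hy, rfl, h⟩ := (mem_reps_one_seven_eight_mul_iff_exists hm).mp hz
    rw [conjugate_natAbs hy, mem_reps_one_seven_eight_mul_iff_exists hm]
    refine ⟨y + 2 * s, -s, hy.add_even (even_two_mul s), rfl, ?_⟩
    rw [← h]
    ring
  · intro z hz
    obtain ⟨y, s, hy, rfl, -⟩ := (mem_reps_one_seven_eight_mul_iff_exists hm).mp hz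
    rw [conjugate_natAbs hy, conjugate_natAbs (hy.add_even (even_two_mul s))]
    congr 2 <;> ring

theorem reps_one_seven_eq_empty {N : ℕ} (hN : ¬ 8 ∣ N) : reps 2 1 7 N = ∅ := by
  refine Finset.eq_empty_of_forall_notMem fun z hz => hN ?_
  obtain ⟨y, t, -, -, h⟩ := mem_reps_one_seven_iff_exists.mp hz
  exact_mod_cast Dvd.intro _ h

theorem card_reps_one_seven_four_mul {M : ℕ} (hM : M % 12 = 8) :
    ((reps 6 1 7 (4 * M)).card : ZMod 2) = (reps 6 1 7 M).card := by
  rw [reps_six_eq_reps_two (by omega), reps_six_eq_reps_two (by omega)]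
  by_cases h8 : 8 ∣ M
  · rw [show 4 * M = 2 * (2 * M) by ring, card_reps_one_seven_two_mul (h8.mul_left 2),
      card_reps_one_seven_two_mul h8]
  · obtain ⟨m, rfl⟩ : 4 ∣ M := by omega
    have heven : Even (reps 2 1 7 (8 * m)).card :=
      even_card_reps_one_seven_eight_mul (by rw [Nat.odd_iff]; omega)
        (not_isSquare_of_mod_three_eq_two (by omega)) (not_isSquare_of_mod_three_eq_two (by omega))
    rw [reps_one_seven_eq_empty h8, show 4 * (4 * m) = 2 * (8 * m) by ring,
      card_reps_one_seven_two_mul (dvd_mul_right 8 m), heven.natCast_zmod_two]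
    simp

theorem genA_two_seven_mul_fModTwo_two :
    genA 2 7 * fModTwo 2 = fModTwo 1 * fModTwo 7 := by
  have h := genA_mul_fModTwo (show Nat.Coprime 2 7 by norm_num)
  rw [fModTwo_two_mul, sq, ← mul_assoc] at h
  exact mul_right_cancel₀ (fModTwo_ne_zero 7) h

theorem mk_coeff_odd_fModTwo_one_mul_fModTwo_seven :
    (PowerSeries.mk fun n => coeff (2 * n + 1) (fModTwo 1 * fModTwo 7)) =
      fModTwo 2 * fModTwo 14 := by
  ext n
  rw [coeff_mk, coeff_fModTwo_mul_fModTwo, coeff_fModTwo_mul_fModTwo,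
    show 24 * (2 * n + 1) + 1 + 7 = 4 * (12 * n + 8) by ring,
    show 24 * n + 2 + 14 = 2 * (12 * n + 8) by ring,
    card_reps_one_seven_four_mul (by omega), ← reps_mul_mul 6 1 7 (12 * n + 8) (c := 2)]

theorem mk_coeff_odd_genA :
    (PowerSeries.mk fun n => coeff (2 * n + 1) (genA 2 7)) = fModTwo 1 * fModTwo 14 := by
  have h2 : fModTwo 2 = fModTwo 1 ^ 2 := fModTwo_two_mul 1
  have h := mk_coeff_odd_fModTwo_one_mul_fModTwo_seven
  rw [← genA_two_seven_mul_fModTwo_two, h2, ← expand_two_eq_sq,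
    mk_coeff_mul_expand two_ne_zero one_lt_two, expand_two_eq_sq] at h
  refine mul_right_cancel₀ (fModTwo_ne_zero 1) (h.trans ?_)
  ring

theorem a_two_seven_eq_card_reps {n : ℕ} (hn : Odd n) :
    (a 2 7 n : ZMod 2) = (reps 6 1 14 (12 * n + 3)).card := by
  obtain ⟨m, rfl⟩ := hn
  have h := congrArg (coeff m) mk_coeff_odd_genA
  rw [coeff_mk, genA, coeff_mk, coeff_fModTwo_mul_fModTwo] at h
  rw [h, show 12 * (2 * m + 1) + 3 = 24 * m + 1 + 14 by ring]

theorem a_two_seven_add_eq_card_reps {m C : ℕ} (hm : Even m) (hC : C % 8 = 5) :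
    (a 2 7 (m + (C - 1) / 4) : ZMod 2) = (reps 6 1 14 (12 * m + 3 * C)).card := by
  rw [a_two_seven_eq_card_reps (hm.add_odd (by rw [Nat.odd_iff]; omega))]
  congr 3
  omega

theorem seriesModEq_two_of_coeff {u : ℕ → ℕ} {b c : ℕ} [NeZero b] [NeZero c]
    (h : ∀ n, (u n : ZMod 2) = (reps 6 b c (24 * n + b + c)).card) :
    SeriesModEq 2 (PowerSeries.mk fun n => (u n : ℤ)) (f b * f c) := by
  intro n
  have hn := h n
  rw [← coeff_fModTwo_mul_fModTwo, fModTwo, fModTwo, ← map_mul, coeff_map] at hn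
  rw [coeff_mk]
  exact (ZMod.intCast_eq_intCast_iff _ _ 2).mp (by simpa using hn)

theorem pow_two_mul_mod_eight {x : ℕ} (hx : Odd x) (α : ℕ) : x ^ (2 * α) % 8 = 1 := by
  have hdvd := Nat.eight_dvd_sq_sub_one_of_odd (hx.pow (n := α))
  have hpos : 0 < (x ^ α) ^ 2 := pow_pos hx.pow.pos 2
  rw [mul_comm, pow_mul]
  omega

section Inert

variable {p : ℕ} [Fact p.Prime] {b : ℕ} [NeZero b]

theorem dvd_of_mem_reps (hleg : legendreSym p (-b) = -1) {d N x y : ℕ} (hN : p ∣ N)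
    (hxy : (x, y) ∈ reps d 1 b N) : p ∣ x ∧ p ∣ y := by
  obtain ⟨-, -, h⟩ := mem_reps.mp hxy
  have hform : (x : ℤ) ^ 2 - -b * (y : ℤ) ^ 2 = N := by
    rw [← h]
    push_cast
    ring
  have hdvd : (p : ℤ) ∣ (x : ℤ) ^ 2 - -b * (y : ℤ) ^ 2 := by
    rw [hform]
    exact_mod_cast hN
  exact_mod_cast legendreSym.prime_dvd_of_eq_neg_one hleg hdvd

theorem card_reps_sq_mul (hleg : legendreSym p (-b) = -1) {d : ℕ} (hpd : p.Coprime d) (N : ℕ) :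
    (reps d 1 b (p ^ 2 * N)).card = (reps d 1 b N).card := by
  have hp : p.Prime := Fact.out
  symm
  refine Finset.card_bij (fun z _ => (p * z.1, p * z.2)) ?_ ?_ ?_
  · rintro ⟨x, y⟩ hz
    obtain ⟨hx, hy, rfl⟩ := mem_reps.mp hz
    exact mem_reps.mpr ⟨hpd.mul_left hx, hpd.mul_left hy, by ring⟩
  · rintro ⟨x, y⟩ - ⟨x', y'⟩ - h
    simpa [hp.ne_zero] using h
  · rintro ⟨x, y⟩ hz
    obtain ⟨⟨x, rfl⟩, ⟨y, rfl⟩⟩ :=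
      dvd_of_mem_reps hleg ((dvd_pow_self p two_ne_zero).mul_right N) hz
    obtain ⟨hx, hy, h⟩ := mem_reps.mp hz
    refine ⟨(x, y), mem_reps.mpr ⟨hx.coprime_mul_left, hy.coprime_mul_left, ?_⟩, rfl⟩
    refine Nat.eq_of_mul_eq_mul_left (pow_pos hp.pos 2) ?_
    rw [← h]
    ring

theorem card_reps_pow_mul (hleg : legendreSym p (-b) = -1) {d : ℕ} (hpd : p.Coprime d)
    (α N : ℕ) : (reps d 1 b (p ^ (2 * α) * N)).card = (reps d 1 b N).card := by
  induction α with
  | zero => simp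
  | succ α ih =>
    rw [show p ^ (2 * (α + 1)) * N = p ^ 2 * (p ^ (2 * α) * N) by ring,
      card_reps_sq_mul hleg hpd, ih]

theorem reps_prime_mul_eq_empty (hleg : legendreSym p (-b) = -1) {d N : ℕ} (hN : ¬ p ∣ N) :
    reps d 1 b (p * N) = ∅ := by
  have hp : p.Prime := Fact.out
  refine Finset.eq_empty_of_forall_notMem fun ⟨x, y⟩ hz => hN ?_
  obtain ⟨⟨x, rfl⟩, ⟨y, rfl⟩⟩ := dvd_of_mem_reps hleg (dvd_mul_right p N) hz
  obtain ⟨-, -, h⟩ := mem_reps.mp hz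
  refine ⟨x ^ 2 + b * y ^ 2, Nat.eq_of_mul_eq_mul_left hp.pos ?_⟩
  rw [← h]
  ring

theorem a_two_seven_eq_card_reps_of_inert (hp : p.Coprime 6) (hleg : legendreSym p (-14) = -1)
    {D c : ℕ} (hD : Even D) (hc : c % 8 = 5) (α n : ℕ) :
    (a 2 7 (D * p ^ (2 * α) * n + (c * p ^ (2 * α) - 1) / 4) : ZMod 2) =
      (reps 6 1 14 (12 * D * n + 3 * c)).card := by
  have hmod : p ^ (2 * α) % 8 = 1 :=
    pow_two_mul_mod_eight (Nat.coprime_two_right.mp (coprime_six_iff.mp hp).1) α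
  have hindex : 12 * (D * p ^ (2 * α) * n) + 3 * (c * p ^ (2 * α)) =
      p ^ (2 * α) * (12 * D * n + 3 * c) := by
    ring
  rw [a_two_seven_add_eq_card_reps ((hD.mul_right _).mul_right n) (by simp [Nat.mul_mod, hc, hmod]),
    hindex, card_reps_pow_mul (b := 14) hleg hp]

theorem a_two_seven_modEq_zero_of_inert {D c : ℕ} (hp : p.Coprime (12 * D))
    (hleg : legendreSym p (-14) = -1) (hD : Even D) (hc : c % 8 = 5) (α n : ℕ) {j : ℕ}
    (hj : 1 ≤ j) (hjp : j ≤ p - 1) :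
    a 2 7 (D * p ^ (2 * α + 1) * (p * n + j) + (c * p ^ (2 * α + 2) - 1) / 4) ≡ 0 [MOD 2] := by
  have hp6 : p.Coprime 6 := hp.coprime_dvd_right (Dvd.intro (2 * D) (by ring))
  have hmod : p ^ (2 * α + 2) % 8 = 1 :=
    pow_two_mul_mod_eight (Nat.coprime_two_right.mp (coprime_six_iff.mp hp6).1) (α + 1)
  have hpj : ¬ p ∣ j := Nat.not_dvd_of_pos_of_lt hj (by omega)
  have hndvd : ¬ p ∣ 12 * D * j + p * (12 * D * n + 3 * c) := by
    rwa [Nat.dvd_add_left (dvd_mul_right _ _), hp.dvd_mul_left]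
  have hindex : 12 * (D * p ^ (2 * α + 1) * (p * n + j)) + 3 * (c * p ^ (2 * α + 2)) =
      p ^ (2 * α) * (p * (12 * D * j + p * (12 * D * n + 3 * c))) := by
    ring
  rw [← ZMod.natCast_eq_natCast_iff,
    a_two_seven_add_eq_card_reps ((hD.mul_right _).mul_right _) (by simp [Nat.mul_mod, hc, hmod]),
    hindex, card_reps_pow_mul (b := 14) hleg hp6, reps_prime_mul_eq_empty (b := 14) hleg hndvd]
  simp

end Inert

end RegularDistinct

theorem theorem1p4 (p : ℕ) [Fact p.Prime] (hp : 7 < p) (hleg : legendreSym p (-14) = -1)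
    (α : ℕ) :
    RegularDistinct.SeriesModEq 2
      (PowerSeries.mk fun n =>
        (RegularDistinct.a 2 7 (2 * p ^ (2 * α) * n + (5 * p ^ (2 * α) - 1) / 4) : ℤ))
      (RegularDistinct.f 1 * RegularDistinct.f 14) ∧
    (∀ n j : ℕ, 1 ≤ j → j ≤ p - 1 →
      RegularDistinct.a 2 7
        (2 * p ^ (2 * α + 1) * (p * n + j) + (5 * p ^ (2 * α + 2) - 1) / 4) ≡ 0 [MOD 2]) ∧
    RegularDistinct.SeriesModEq 2
      (PowerSeries.mk fun n =>
        (RegularDistinct.a 2 7 (14 * p ^ (2 * α) * n + (21 * p ^ (2 * α) - 1) / 4) : ℤ))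
      (RegularDistinct.f 2 * RegularDistinct.f 7) ∧
    (∀ n j : ℕ, 1 ≤ j → j ≤ p - 1 →
      RegularDistinct.a 2 7
        (14 * p ^ (2 * α + 1) * (p * n + j) + (21 * p ^ (2 * α + 2) - 1) / 4) ≡ 0 [MOD 2]) := by
  open RegularDistinct in
  have hp168 : p.Coprime 168 :=
    ((Fact.out : p.Prime).coprime_factorial_of_lt hp).coprime_dvd_right (by decide)
  have hp6 : p.Coprime 6 := hp168.coprime_dvd_right (by norm_num)
  refine ⟨seriesModEq_two_of_coeff fun n => ?_, fun n j => ?_,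
    seriesModEq_two_of_coeff fun n => ?_, fun n j => ?_⟩
  · exact a_two_seven_eq_card_reps_of_inert hp6 hleg even_two (by norm_num) α n
  · exact a_two_seven_modEq_zero_of_inert (hp168.coprime_dvd_right (by norm_num)) hleg even_two
      (by norm_num) α n
  · rw [a_two_seven_eq_card_reps_of_inert hp6 hleg (by decide) (by norm_num) α n,
      show 12 * 14 * n + 3 * 21 = 7 * (24 * n + 2 + 7) by ring,
      show 14 = 7 * 2 by norm_num, card_reps_one_mul_prime (by norm_num) (by norm_num)]
  · exact a_two_seven_modEq_zero_of_inert hp168 hleg (by decide) (by norm_num) α n
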